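/- All spaces are Tychonoff (completely regular and Hausdorff). A space is *realcompact* if every family $\mathcal S$ of closed sets with the finite intersection property such that each $f\in C(X)$ is bounded on some member of $\mathcal S$ has nonempty intersection. A closed set $H\subseteq X$ is *hard* in $X$ if there is a compact $K\subseteq X$ such that for every open $V\supseteq K$ there is a realcompact subspace $P\subseteq X$ with $H\setminus V$ completely separated from $X\setminus P$. A $z$-filter on $X$ is an *$hz$-filter* if it has a base of hard zero sets; an *$hz$-ultrafilter* is a maximal $hz$-filter. A $z$-filter is *fixed* if its members have a common point. If $X\subseteq T$, a $z$-filter $\mathcal F$ on $X$ *converges* to $p\in T$ (has limit $p$) if every neighbourhood of $p$ in $T$ contains a member of $\mathcal F$. A continuous map $f:X\to Y$ is *h2pc* if $\mathrm{cl}_Y f(H)$ is compact for every hard $H\subseteq X$. $X$ is *$S$-embedded* in $T\supseteq X$ if every $f\in C(X)$ that is bounded on each hard subset of $X$ extends continuously to $T$. A space $Y$ is *nearly pseudocompact* if $Y=Y_1\cup Y_2$ with $\mathrm{int}_Y(Y_1\cap Y_2)=\emptyset$, where $Y_1$ is regular closed, pseudocompact, and equal to the closure of the set of points of $Y$ having compact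 neighbourhoods, and $Y_2$ is regular closed and no point of $Y_2$ has a realcompact neighbourhood in $Y_2$. **Theorem.** (A) Let $X$ be dense in $T$ and suppose that every point of $T\setminus X$ lies in the $T$-closure of some hard subset of $X$. Then the following are equivalent: 1. every h2pc map from $X$ to a Tychonoff space $Y$ extends to a continuous map $T\to Y$; 2. $X$ is $S$-embedded in $T$; 3. for any zero sets $Z_1,Z_2$ of $X$ with $Z_1\cap Z_2=\emptyset$ one has $\mathrm{cl}_T Z_1\cap \mathrm{cl}_T Z_2=\emptyset$; 4. for any zero sets $Z_1,Z_2$ of $X$, $\mathrm{cl}_T(Z_1\cap Z_2)=\mathrm{cl}_T Z_1\cap\mathrm{cl}_T Z_2$; 5. every point of $T$ is the limit of a unique $z$-ultrafilter on $X$, and this $z$-ultrafilter is either fixed or an $hz$-ultrafilter. (B) For a Tychonoff space $X$ let $\delta X$ be the set of all fixed $z$-ultrafilters and all $hz$-ultrafilters on $X$, with the topology for which the sets $\{p\in\delta X: Z\in p\}$, $Z$ a zero set of $X$, form a base of closed sets, and identify $x\in X$ with the fixed $z$-ultrafilter of all zero sets containing $x$. Then $\delta X$ is a nearly pseudocompact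 Tychonoff space in which $X$ is densely embedded, every point of $\delta X\setminus X$ lies in the $\delta X$-closure of a hard subset of $X$, and conditions 1–5 hold for $T=\delta X$. Moreover every fixed $z$-ultrafilter and every $hz$-ultrafilter on $X$ converges in $\delta X$. -/

import Mathlib

open Set Topology

universe u v w

/-- Zero sets of continuous real-valued functions. -/
def IsZeroSet {X : Type u} [TopologicalSpace X] (Z : Set X) : Prop :=
  ∃ f : C(X, ℝ), Z = {x | f x = 0}

/-- `A` and `B` are completely separated in `X`. -/
def CompletelySeparated {X : Type u} [TopologicalSpace X] (A B : Set X) : Prop :=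
  ∃ f : C(X, ℝ), (∀ x, f x ∈ Icc (0 : ℝ) 1) ∧ (∀ x ∈ A, f x = 0) ∧ (∀ x ∈ B, f x = 1)

/-- A family of sets is stable if every continuous real-valued function is bounded on some
member of it. -/
def IsStableFamily {X : Type u} [TopologicalSpace X] (S : Set (Set X)) : Prop :=
  ∀ f : C(X, ℝ), ∃ D ∈ S, Bornology.IsBounded (f '' D)

/-- A space is realcompact if every stable family of closed sets with the finite intersection
property is fixed, i.e. has nonempty intersection. -/
def IsRealcompactSpace (X : Type u) [TopologicalSpace X] : Prop :=
  ∀ S : Set (Set X), (∀ A ∈ S, IsClosed A) → IsStableFamily S →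
    (∀ s ⊆ S, s.Finite → (⋂₀ s).Nonempty) → (⋂₀ S).Nonempty

/-- Hard subsets of `X`; a subset `P` is realcompact if it is so as a subspace. -/
def IsHard {X : Type u} [TopologicalSpace X] (H : Set X) : Prop :=
  IsClosed H ∧ ∃ K : Set X, IsCompact K ∧ ∀ V : Set X, IsOpen V → K ⊆ V →
    ∃ P : Set X, IsRealcompactSpace P ∧ CompletelySeparated (H \ V) Pᶜ

/-! Nearly pseudocompact spaces. -/

def IsPseudocompactSpace (X : Type u) [TopologicalSpace X] : Prop :=
  ∀ f : C(X, ℝ), Bornology.IsBounded (range f)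

/-- No point has a realcompact neighbourhood. -/
def IsAntiLocallyRealcompactSpace (X : Type u) [TopologicalSpace X] : Prop :=
  ∀ x : X, ∀ N ∈ 𝓝 x, ¬ IsRealcompactSpace N

def IsRegularClosed {X : Type u} [TopologicalSpace X] (A : Set X) : Prop :=
  closure (interior A) = A

/-- A subset of `X` is almost locally compact if it is the closure of the set of all points of `X`
having compact neighbourhoods. -/
def IsAlmostLocallyCompact {X : Type u} [TopologicalSpace X] (A : Set X) : Prop :=
  A = closure {x : X | ∃ N ∈ 𝓝 x, IsCompact N}

def IsNearlyPseudocompactSpace (X : Type u) [TopologicalSpace X] : Prop :=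
  ∃ X₁ X₂ : Set X, X₁ ∪ X₂ = univ ∧
    (IsRegularClosed X₁ ∧ IsAlmostLocallyCompact X₁ ∧ IsPseudocompactSpace X₁) ∧
    (IsRegularClosed X₂ ∧ IsAntiLocallyRealcompactSpace X₂) ∧
    interior (X₁ ∩ X₂) = ∅

/-! z-filters and hz-filters, as families of zero sets. -/

structure IsZFilter {X : Type u} [TopologicalSpace X] (F : Set (Set X)) : Prop where
  isZeroSet : ∀ Z ∈ F, IsZeroSet Z
  nonempty : F.Nonempty
  empty_notMem : ∅ ∉ F
  inter_mem : ∀ Z₁ ∈ F, ∀ Z₂ ∈ F, Z₁ ∩ Z₂ ∈ F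
  superset_mem : ∀ Z ∈ F, ∀ W, IsZeroSet W → Z ⊆ W → W ∈ F

/-- z-ultrafilters are the maximal z-filters. -/
def IsZUltrafilter {X : Type u} [TopologicalSpace X] (F : Set (Set X)) : Prop :=
  Maximal IsZFilter F

/-- A z-ultrafilter is fixed if its members have a common point. -/
def IsFixedZUltrafilter {X : Type u} [TopologicalSpace X] (F : Set (Set X)) : Prop :=
  IsZUltrafilter F ∧ (⋂₀ F).Nonempty

/-- An hz-filter is a z-filter having a base of hard zero sets. -/
def IsHzFilter {X : Type u} [TopologicalSpace X] (F : Set (Set X)) : Prop :=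
  IsZFilter F ∧ ∀ Z ∈ F, ∃ H ∈ F, IsHard H ∧ H ⊆ Z

/-- hz-ultrafilters are the maximal hz-filters. -/
def IsHzUltrafilter {X : Type u} [TopologicalSpace X] (F : Set (Set X)) : Prop :=
  Maximal IsHzFilter F

/-- A family `F` of subsets of `X` converges to `p` in `T`, where `X` is regarded as a subset
of `T` through `e`: every neighbourhood of `p` in `T` contains a member of `F`. -/
def ConvergesIn {X : Type u} {T : Type v} [TopologicalSpace T] (e : X → T)
    (F : Set (Set X)) (p : T) : Prop :=
  ∀ N ∈ 𝓝 p, ∃ Z ∈ F, e '' Z ⊆ N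

/-- h2pc maps: continuous maps taking hard sets to sets with compact closure. -/
def IsH2pc {X : Type u} {Y : Type v} [TopologicalSpace X] [TopologicalSpace Y]
    (f : X → Y) : Prop :=
  Continuous f ∧ ∀ H : Set X, IsHard H → IsCompact (closure (f '' H))

/-- Continuous real-valued functions that are bounded on every hard set. -/
def IsHardBounded {X : Type u} [TopologicalSpace X] (f : X → ℝ) : Prop :=
  Continuous f ∧ ∀ H : Set X, IsHard H → Bornology.IsBounded (f '' H)

/-! The five conditions on a dense embedding `e : X → T`. -/

/-- Every h2pc map from `X` to a Tychonoff space extends continuously to `T`. -/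
def H2pcMapsExtend {X : Type u} {T : Type v} [TopologicalSpace X] [TopologicalSpace T]
    (e : X → T) : Prop :=
  ∀ (Y : Type w) [TopologicalSpace Y] [T35Space Y] (τ : X → Y), IsH2pc τ →
    ∃ τ' : T → Y, Continuous τ' ∧ ∀ x, τ' (e x) = τ x

/-- `X` is S-embedded in `T`. -/
def IsSEmbedded {X : Type u} {T : Type v} [TopologicalSpace X] [TopologicalSpace T]
    (e : X → T) : Prop :=
  ∀ f : X → ℝ, IsHardBounded f → ∃ f' : T → ℝ, Continuous f' ∧ ∀ x, f' (e x) = f x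

/-- Disjoint zero sets of `X` have disjoint closures in `T`. -/
def DisjointZeroSetClosures {X : Type u} {T : Type v} [TopologicalSpace X] [TopologicalSpace T]
    (e : X → T) : Prop :=
  ∀ Z₁ Z₂ : Set X, IsZeroSet Z₁ → IsZeroSet Z₂ → Z₁ ∩ Z₂ = ∅ →
    closure (e '' Z₁) ∩ closure (e '' Z₂) = ∅

/-- Closure in `T` commutes with intersections of two zero sets of `X`. -/
def ZeroSetClosuresInter {X : Type u} {T : Type v} [TopologicalSpace X] [TopologicalSpace T]
    (e : X → T) : Prop :=
  ∀ Z₁ Z₂ : Set X, IsZeroSet Z₁ → IsZeroSet Z₂ →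
    closure (e '' (Z₁ ∩ Z₂)) = closure (e '' Z₁) ∩ closure (e '' Z₂)

/-- Every point of `T` is the limit of a unique z-ultrafilter on `X`, and this z-ultrafilter is
fixed or an hz-ultrafilter. -/
def PointsAreUniqueLimits {X : Type u} {T : Type v} [TopologicalSpace X] [TopologicalSpace T]
    (e : X → T) : Prop :=
  ∀ p : T, ∃ U : Set (Set X), (IsFixedZUltrafilter U ∨ IsHzUltrafilter U) ∧ ConvergesIn e U p ∧
    ∀ V : Set (Set X), IsZUltrafilter V → ConvergesIn e V p → V = U

/-! The extension of `X` by its hz-ultrafilters. -/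

/-- The set of all fixed z-ultrafilters and all hz-ultrafilters on `X`. -/
def DeltaExt (X : Type u) [TopologicalSpace X] : Type u :=
  {p : Set (Set X) // IsFixedZUltrafilter p ∨ IsHzUltrafilter p}

/-- The topology for which the sets `{p | Z ∈ p}`, `Z` a zero set of `X`, are a base of closed
sets. -/
instance DeltaExt.instTopologicalSpace (X : Type u) [TopologicalSpace X] :
    TopologicalSpace (DeltaExt X) :=
  TopologicalSpace.generateFrom
    {U | ∃ Z : Set X, IsZeroSet Z ∧ U = {p : DeltaExt X | Z ∈ p.1}ᶜ}

/-- The family of all zero sets containing `x`. -/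
def zeroSetsAt {X : Type u} [TopologicalSpace X] (x : X) : Set (Set X) :=
  {Z | IsZeroSet Z ∧ x ∈ Z}

theorem isFixedZUltrafilter_zeroSetsAt {X : Type u} [TopologicalSpace X] (x : X) :
    IsFixedZUltrafilter (zeroSetsAt x) := by
  refine ⟨⟨⟨fun Z hZ => hZ.1, ⟨univ, ⟨0, by ext; simp⟩, mem_univ x⟩, fun h => h.2, ?_,
    fun Z hZ W hW h => ⟨hW, h hZ.2⟩⟩, ?_⟩, x, fun Z hZ => hZ.2⟩
  · rintro _ ⟨⟨f, rfl⟩, hf⟩ _ ⟨⟨g, rfl⟩, hg⟩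
    refine ⟨⟨f * f + g * g, ?_⟩, hf, hg⟩
    ext y
    simp only [mem_inter_iff, mem_ofPred_eq, ContinuousMap.add_apply, ContinuousMap.mul_apply]
    constructor
    · rintro ⟨h1, h2⟩
      simp [h1, h2]
    · intro h
      exact ⟨by nlinarith [mul_self_nonneg (f y), mul_self_nonneg (g y)],
        by nlinarith [mul_self_nonneg (f y), mul_self_nonneg (g y)]⟩
  · intro G hG hle Z hZ
    refine ⟨hG.isZeroSet Z hZ, ?_⟩
    by_contra hx
    obtain ⟨f, rfl⟩ := hG.isZeroSet Z hZ
    have hW : {y | (f - ContinuousMap.const X (f x)) y = 0} ∈ G :=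
      hle ⟨⟨_, rfl⟩, by simp⟩
    have h := hG.inter_mem _ hZ _ hW
    have he : {y | f y = 0} ∩ {y | (f - ContinuousMap.const X (f x)) y = 0} = ∅ := by
      ext y
      simp only [mem_inter_iff, mem_ofPred_eq, ContinuousMap.sub_apply, ContinuousMap.const_apply,
        mem_empty_iff_false, iff_false, not_and]
      intro h1 h2
      exact hx (by simp only [mem_ofPred_eq]; linarith)
    exact hG.empty_notMem (he ▸ h)

/-- The canonical map identifying a point `x` with the fixed z-ultrafilter at `x`. -/
def DeltaExt.of (X : Type u) [TopologicalSpace X] (x : X) : DeltaExt X :=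
  ⟨zeroSetsAt x, Or.inl (isFixedZUltrafilter_zeroSetsAt x)⟩

/-! Everything runs through the trace of a point `p` of `T`: the zero sets of `X` whose `T`-closure
contains `p`.

For (A) the implications are 1 → 2 → 3 → 4 → 5 → 3 → 1. A hard-bounded function is h2pc, and
`[0,1]`-valued functions are hard-bounded and separate disjoint zero sets; this gives 3. Localising
near `p` turns 3 into 4, and 4 makes the trace a z-ultrafilter, the only one converging to `p`. It
has a hard member when `p` lies outside `X`. Conversely, a unique limit ultrafilter must contain the
whole trace, which returns 3. For 3 → 1, an h2pc map has a cluster value at `p` along a hard set,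
and disjointness of closures upgrades it to a limit.

For (B), z-ultrafilters on `X` are exactly the traces of points of `βX`, so `δX` embeds in `βX` by
`DeltaExt.limit`. Let `Q = υX \ X` be the Hewitt remainder. Outside `X`, a point of `βX` is in the
closure of a hard set iff it is off `cl Q`, so the image of `δX` is `X ∪ (βX \ cl Q)`. Condition 3
is inherited from `βX`, and (A) gives the others. Functions on `δX` stay bounded near `Q`; hence a
point with a realcompact neighbourhood has its limit off `cl Q`, and the set `L` of points with
compact neighbourhoods is `δX \ cl Q`. The decomposition is `cl L` and the closure of its
complement. Pseudocompactness of `cl L` is the hard step,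
`DeltaExt.exists_le_on_locallyCompactPoints`: a function unbounded on `L` is cut off by bumps and
extended by zero to `δX`, and boundedness near `Q` forces the bumps to accumulate at a point of `L`.
-/

open Filter

/-! ### Zero sets and complete separation. -/

section ZeroSets

variable {X : Type u} [TopologicalSpace X]

theorem isZeroSet_le {f : X → ℝ} (hf : Continuous f) (c : ℝ) : IsZeroSet {x | f x ≤ c} :=
  ⟨⟨fun x => max (f x - c) 0, by fun_prop⟩, by ext; simp⟩

theorem isZeroSet_ge {f : X → ℝ} (hf : Continuous f) (c : ℝ) : IsZeroSet {x | c ≤ f x} :=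
  ⟨⟨fun x => max (c - f x) 0, by fun_prop⟩, by ext; simp⟩

theorem isZeroSet_univ : IsZeroSet (univ : Set X) :=
  ⟨0, by ext; simp⟩

theorem IsZeroSet.isClosed {Z : Set X} (h : IsZeroSet Z) : IsClosed Z := by
  obtain ⟨f, rfl⟩ := h
  exact isClosed_eq f.continuous continuous_const

theorem IsZeroSet.inter {Z W : Set X} (hZ : IsZeroSet Z) (hW : IsZeroSet W) :
    IsZeroSet (Z ∩ W) := by
  obtain ⟨f, rfl⟩ := hZ
  obtain ⟨g, rfl⟩ := hW
  refine ⟨⟨fun x => |f x| + |g x|, by fun_prop⟩, ?_⟩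
  ext x
  have h1 := abs_nonneg (f x)
  have h2 := abs_nonneg (g x)
  simp only [mem_inter_iff, mem_ofPred_eq, ContinuousMap.coe_mk]
  constructor
  · rintro ⟨h, h'⟩
    simp [h, h']
  · intro h
    exact ⟨abs_eq_zero.1 (by linarith), abs_eq_zero.1 (by linarith)⟩

/-- Disjoint zero sets are completely separated. -/
theorem IsZeroSet.completelySeparated {Z W : Set X} (hZ : IsZeroSet Z) (hW : IsZeroSet W)
    (h : Z ∩ W = ∅) : CompletelySeparated Z W := by
  obtain ⟨f, rfl⟩ := hZ
  obtain ⟨g, rfl⟩ := hW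
  have hpos : ∀ x, 0 < |f x| + |g x| := by
    intro x
    by_contra hx
    have h1 := abs_nonneg (f x)
    have h2 := abs_nonneg (g x)
    have : x ∈ {x | f x = 0} ∩ {x | g x = 0} :=
      ⟨abs_eq_zero.1 (by linarith), abs_eq_zero.1 (by linarith)⟩
    simp [h] at this
  refine ⟨⟨fun x => |f x| / (|f x| + |g x|), ?_⟩, ?_, ?_, ?_⟩
  · exact Continuous.div (by fun_prop) (by fun_prop) fun x => (hpos x).ne'
  · intro x
    refine ⟨by simp only [ContinuousMap.coe_mk]; positivity, ?_⟩
    simp only [ContinuousMap.coe_mk]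
    rw [div_le_one (hpos x)]
    linarith [abs_nonneg (g x)]
  · intro x hx
    have : f x = 0 := hx
    simp [this]
  · intro x hx
    have hx : g x = 0 := hx
    have := (hpos x).ne'
    simp only [ContinuousMap.coe_mk]
    simp only [hx, abs_zero, add_zero] at this ⊢
    exact div_self this

/-- In a completely regular space points and complements of neighbourhoods are separated by
continuous real-valued functions. -/
theorem exists_separating_function [CompletelyRegularSpace X] {p : X} {N : Set X}
    (hN : N ∈ 𝓝 p) :
    ∃ g : X → ℝ, Continuous g ∧ (∀ x, g x ∈ Icc (0 : ℝ) 1) ∧ g p = 0 ∧ ∀ x, x ∉ N → g x = 1 := by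
  obtain ⟨f, hf, hp, h1⟩ := CompletelyRegularSpace.completely_regular_isOpen p (interior N)
    isOpen_interior (mem_interior_iff_mem_nhds.2 hN)
  refine ⟨fun x => f x, by fun_prop, fun x => (f x).2, by simp [hp], fun x hx => ?_⟩
  have : f x = 1 := h1 fun h => hx (interior_subset h)
  simp [this]

theorem IsDenseInducing.mem_closure_image_of_mem_nhds {T : Type v} [TopologicalSpace T]
    {e : X → T} (he : IsDenseInducing e) {p : T} {N : Set T} (hN : N ∈ 𝓝 p) :
    p ∈ closure (e '' (e ⁻¹' N)) := by
  rw [mem_closure_iff_nhds]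
  intro M hM
  obtain ⟨y, hy, x, rfl⟩ := mem_closure_iff_nhds.1 (he.dense p) _ (inter_mem hM hN)
  exact ⟨e x, hy.1, x, hy.2, rfl⟩

theorem IsDenseInducing.mem_of_mem_closure_image {T : Type v} [TopologicalSpace T]
    {e : X → T} (he : IsDenseInducing e) {x : X} {Z : Set X} (hZ : IsClosed Z)
    (h : e x ∈ closure (e '' Z)) : x ∈ Z := by
  rwa [← mem_preimage, ← he.isInducing.closure_eq_preimage_closure_image, hZ.closure_eq] at h

end ZeroSets

/-! ### Hard sets. -/

section Hard

variable {X : Type u} [TopologicalSpace X]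

theorem CompletelySeparated.mono {A B A' B' : Set X} (h : CompletelySeparated A B)
    (hA : A' ⊆ A) (hB : B' ⊆ B) : CompletelySeparated A' B' := by
  obtain ⟨f, h1, h2, h3⟩ := h
  exact ⟨f, h1, fun x hx => h2 x (hA hx), fun x hx => h3 x (hB hx)⟩

theorem IsHard.mono {H H' : Set X} (h : IsHard H) (hc : IsClosed H') (hs : H' ⊆ H) :
    IsHard H' := by
  obtain ⟨-, K, hK, hV⟩ := h
  refine ⟨hc, K, hK, fun V hVo hKV => ?_⟩
  obtain ⟨P, hP, hsep⟩ := hV V hVo hKV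
  exact ⟨P, hP, hsep.mono (sdiff_subset_sdiff_left hs) subset_rfl⟩

theorem isHard_of_completelySeparated {H P : Set X} (hH : IsClosed H)
    (hP : IsRealcompactSpace P) (h : CompletelySeparated H Pᶜ) : IsHard H :=
  ⟨hH, ∅, isCompact_empty, fun _ _ _ => ⟨P, hP, h.mono sdiff_subset subset_rfl⟩⟩

/-- A point outside `X` in the closure of a hard set is in the closure of a zero set that is
completely separated from the complement of a realcompact set. -/
theorem exists_function_of_mem_closure_isHard {T : Type v} [TopologicalSpace T] [T3Space T]
    {e : X → T} (he : IsDenseInducing e) {p : T} (hp : p ∉ range e) {H : Set X} (hH : IsHard H)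
    (hpH : p ∈ closure (e '' H)) :
    ∃ P : Set X, IsRealcompactSpace P ∧ ∃ f : C(X, ℝ), (∀ x, f x ∈ Icc (0 : ℝ) 1) ∧
      p ∈ closure (e '' {x | f x = 0}) ∧ ∀ x ∉ P, f x = 1 := by
  obtain ⟨-, K, hK, hV⟩ := hH
  have hKc : IsCompact (e '' K) := hK.image he.isInducing.continuous
  have hpK : (e '' K)ᶜ ∈ 𝓝 p := hKc.isClosed.isOpen_compl.mem_nhds (by
    rintro ⟨x, -, rfl⟩
    exact hp ⟨x, rfl⟩)
  -- The compact set `K` is closed in `T` and misses `p`. With `V` the complement of the trace of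
  -- `N`, the part `H \ V` is `H` inside `N`, which still accumulates at `p`.
  obtain ⟨N, hN, hNc, hNK⟩ := exists_mem_nhds_isClosed_subset hpK
  obtain ⟨P, hP, f, hf, h0, h1⟩ := hV (e ⁻¹' N)ᶜ
    (hNc.preimage he.isInducing.continuous).isOpen_compl
    (fun x hx hxN => hNK hxN ⟨x, hx, rfl⟩)
  refine ⟨P, hP, f, hf, ?_, fun x hx => h1 x hx⟩
  rw [mem_closure_iff_nhds]
  intro M hM
  obtain ⟨_, hy, x, hx, rfl⟩ := mem_closure_iff_nhds.1 hpH _ (inter_mem hM hN)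
  exact ⟨e x, hy.1, x, h0 x ⟨hx, fun h => h hy.2⟩, rfl⟩

theorem exists_isHard_isZeroSet {T : Type v} [TopologicalSpace T] [T3Space T]
    {e : X → T} (he : IsDenseInducing e) {p : T} (hp : p ∉ range e) {H : Set X} (hH : IsHard H)
    (hpH : p ∈ closure (e '' H)) :
    ∃ Z : Set X, IsZeroSet Z ∧ IsHard Z ∧ p ∈ closure (e '' Z) := by
  obtain ⟨P, hP, f, hf, h0, h1⟩ := exists_function_of_mem_closure_isHard he hp hH hpH
  exact ⟨{x | f x = 0}, ⟨f, rfl⟩,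
    isHard_of_completelySeparated (isClosed_eq f.continuous continuous_const) hP
      ⟨f, hf, fun x hx => hx, h1⟩, h0⟩

end Hard

/-! ### z-filters and traces of points of an extension. -/

section Filters

variable {X : Type u} [TopologicalSpace X]

theorem IsZFilter.nonempty_of_mem {F : Set (Set X)} (hF : IsZFilter F) {Z : Set X} (hZ : Z ∈ F) :
    Z.Nonempty :=
  nonempty_iff_ne_empty.2 fun h => hF.empty_notMem (h ▸ hZ)

theorem IsZUltrafilter.isZFilter {U : Set (Set X)} (hU : IsZUltrafilter U) : IsZFilter U :=
  hU.prop

theorem IsZFilter.sInter_mem {F : Set (Set X)} (hF : IsZFilter F) {s : Set (Set X)}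
    (hs : s.Finite) (hsF : s ⊆ F) : ⋂₀ s ∈ F := by
  induction s, hs using Set.Finite.induction_on with
  | empty =>
    obtain ⟨Z, hZ⟩ := hF.nonempty
    rw [sInter_empty]
    exact hF.superset_mem Z hZ _ isZeroSet_univ (subset_univ _)
  | insert _ _ ih =>
    rw [sInter_insert]
    exact hF.inter_mem _ (hsF (mem_insert _ _)) _ (ih ((subset_insert _ _).trans hsF))

/-- The family of all zero sets of `X` whose closure in `T` contains `p`. -/
def zeroSetTrace {T : Type v} [TopologicalSpace T] (e : X → T) (p : T) : Set (Set X) :=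
  {Z | IsZeroSet Z ∧ p ∈ closure (e '' Z)}

section Trace

variable {T : Type v} [TopologicalSpace T] [CompletelyRegularSpace T] {e : X → T}

/-- Every neighbourhood in `T` has a member of the trace inside it. -/
theorem exists_mem_zeroSetTrace (he : IsDenseInducing e) {p : T} {N : Set T} (hN : N ∈ 𝓝 p) :
    ∃ Z ∈ zeroSetTrace e p, e '' Z ⊆ N ∧ ∃ M ∈ 𝓝 p, e ⁻¹' M ⊆ Z := by
  obtain ⟨g, hg, hg01, hgp, hgN⟩ := exists_separating_function hN
  have hM : {x | g x ≤ 1 / 2} ∈ 𝓝 p :=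
    (hg.tendsto p).eventually_le_const (by norm_num [hgp])
  refine ⟨{x | g (e x) ≤ 1 / 2}, ⟨isZeroSet_le (hg.comp he.isInducing.continuous) _,
    he.mem_closure_image_of_mem_nhds hM⟩, ?_, _, hM, subset_rfl⟩
  rintro _ ⟨x, hx, rfl⟩
  by_contra h
  have := hgN _ h
  rw [mem_ofPred_eq, this] at hx
  norm_num at hx

theorem DisjointZeroSetClosures.zeroSetClosuresInter (he : IsDenseInducing e)
    (h : DisjointZeroSetClosures e) : ZeroSetClosuresInter e := by
  intro Z₁ Z₂ h₁ h₂
  refine Subset.antisymm (subset_inter (closure_mono (image_mono inter_subset_left))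
    (closure_mono (image_mono inter_subset_right))) ?_
  rintro p ⟨hp₁, hp₂⟩
  by_contra hp
  obtain ⟨W, hW, hWs, M, hM, hMW⟩ := exists_mem_zeroSetTrace he
    (isClosed_closure.isOpen_compl.mem_nhds hp)
  -- Cutting down to `W` does not lose `p`, because `W` contains the trace of a whole neighbourhood
  -- of `p`.
  have hmem : ∀ Z : Set X, p ∈ closure (e '' Z) → p ∈ closure (e '' (Z ∩ W)) := by
    intro Z hZ
    rw [mem_closure_iff_nhds] at hZ ⊢
    intro N hN
    obtain ⟨_, hy, x, hx, rfl⟩ := hZ _ (inter_mem hN hM)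
    exact ⟨e x, hy.1, x, ⟨hx, hMW hy.2⟩, rfl⟩
  have hdis : (Z₁ ∩ W) ∩ (Z₂ ∩ W) = ∅ := by
    rw [eq_empty_iff_forall_notMem]
    rintro x ⟨⟨hx₁, hxW⟩, hx₂, -⟩
    exact hWs ⟨x, hxW, rfl⟩ (subset_closure ⟨x, ⟨hx₁, hx₂⟩, rfl⟩)
  have := h _ _ (h₁.inter hW.1) (h₂.inter hW.1) hdis
  exact (this ▸ ⟨hmem _ hp₁, hmem _ hp₂⟩ : p ∈ (∅ : Set T))

/-- The hypothesis is used only for closure under intersection. Maximality comes from complete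
regularity: a zero set whose closure misses `p` is disjoint from some member of the trace. -/
theorem ZeroSetClosuresInter.isZUltrafilter_zeroSetTrace (he : IsDenseInducing e)
    (h : ZeroSetClosuresInter e) (p : T) : IsZUltrafilter (zeroSetTrace e p) := by
  refine ⟨⟨fun Z hZ => hZ.1, ⟨univ, isZeroSet_univ, ?_⟩, ?_, ?_, ?_⟩, ?_⟩
  · rw [image_univ]
    exact he.dense p
  · rintro ⟨-, h'⟩
    simp at h'
  · rintro Z₁ h₁ Z₂ h₂
    exact ⟨h₁.1.inter h₂.1, h _ _ h₁.1 h₂.1 ▸ ⟨h₁.2, h₂.2⟩⟩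
  · intro Z hZ W hW hZW
    exact ⟨hW, closure_mono (image_mono hZW) hZ.2⟩
  · intro G hG hle Z hZ
    refine ⟨hG.isZeroSet Z hZ, ?_⟩
    by_contra hp
    obtain ⟨W, hW, hWs, -⟩ := exists_mem_zeroSetTrace he
      (isClosed_closure.isOpen_compl.mem_nhds hp)
    obtain ⟨x, hxZ, hxW⟩ := hG.nonempty_of_mem (hG.inter_mem _ hZ _ (hle hW))
    exact hWs ⟨x, hxW, rfl⟩ (subset_closure ⟨x, hxZ, rfl⟩)

theorem convergesIn_zeroSetTrace (he : IsDenseInducing e) (p : T) :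
    ConvergesIn e (zeroSetTrace e p) p := fun _ hN =>
  let ⟨Z, hZ, hZN, _⟩ := exists_mem_zeroSetTrace he hN
  ⟨Z, hZ, hZN⟩

end Trace

theorem IsZFilter.subset_zeroSetTrace_of_convergesIn {T : Type v} [TopologicalSpace T] {e : X → T}
    {F : Set (Set X)} (hF : IsZFilter F) {p : T} (h : ConvergesIn e F p) :
    F ⊆ zeroSetTrace e p := by
  refine fun Z hZ => ⟨hF.isZeroSet Z hZ, mem_closure_iff_nhds.2 fun N hN => ?_⟩
  obtain ⟨W, hW, hWN⟩ := h N hN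
  obtain ⟨x, hxZ, hxW⟩ := hF.nonempty_of_mem (hF.inter_mem _ hZ _ hW)
  exact ⟨e x, hWN ⟨x, hxW, rfl⟩, x, hxZ, rfl⟩

/-- Only `[0,1]`-valued functions need to extend, so this serves both `βX` and S-embedding. -/
theorem CompletelySeparated.disjoint_closure {T : Type v} [TopologicalSpace T] {e : X → T}
    {A B : Set X} (h : CompletelySeparated A B)
    (hext : ∀ f : C(X, ℝ), (∀ x, f x ∈ Icc (0 : ℝ) 1) →
      ∃ f' : T → ℝ, Continuous f' ∧ ∀ x, f' (e x) = f x) :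
    closure (e '' A) ∩ closure (e '' B) = ∅ := by
  obtain ⟨f, hf, h0, h1⟩ := h
  obtain ⟨f', hf', hfe⟩ := hext f hf
  have hA : closure (e '' A) ⊆ f' ⁻¹' {0} := closure_minimal
    (by rintro _ ⟨x, hx, rfl⟩; simp [hfe, h0 x hx]) (isClosed_singleton.preimage hf')
  have hB : closure (e '' B) ⊆ f' ⁻¹' {1} := closure_minimal
    (by rintro _ ⟨x, hx, rfl⟩; simp [hfe, h1 x hx]) (isClosed_singleton.preimage hf')
  rw [eq_empty_iff_forall_notMem]
  rintro p ⟨hpA, hpB⟩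
  have h0 : f' p = 0 := hA hpA
  have h1 : f' p = 1 := hB hpB
  linarith

end Filters

/-! ### z-ultrafilters as points of the Stone–Čech compactification. -/

section StoneCechZ

variable {X : Type u} [TopologicalSpace X]

theorem exists_stoneCech_extension {f : X → ℝ} (hf : Continuous f)
    (h : ∀ x, f x ∈ Icc (0 : ℝ) 1) :
    ∃ f' : StoneCech X → ℝ, Continuous f' ∧ ∀ x, f' (stoneCechUnit x) = f x := by
  have hc : Continuous fun x => (⟨f x, h x⟩ : Icc (0 : ℝ) 1) := by fun_prop
  refine ⟨fun b => (stoneCechExtend hc b : Icc (0 : ℝ) 1),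
    continuous_subtype_val.comp (continuous_stoneCechExtend hc),
    fun x => ?_⟩
  simp only [stoneCechExtend_stoneCechUnit]

theorem disjointZeroSetClosures_stoneCechUnit :
    DisjointZeroSetClosures (stoneCechUnit : X → StoneCech X) :=
  fun _ _ h₁ h₂ h => (h₁.completelySeparated h₂ h).disjoint_closure
    fun f hf => exists_stoneCech_extension f.continuous hf

theorem isZUltrafilter_zeroSetTrace_stoneCech [T35Space X] (b : StoneCech X) :
    IsZUltrafilter (zeroSetTrace stoneCechUnit b) :=
  (disjointZeroSetClosures_stoneCechUnit.zeroSetClosuresInter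
    isDenseInducing_stoneCechUnit).isZUltrafilter_zeroSetTrace isDenseInducing_stoneCechUnit b

/-- By compactness of `βX` the image of the filter has a cluster point, and this point serves as
`b`. -/
theorem IsZFilter.exists_subset_zeroSetTrace {F : Set (Set X)} (hF : IsZFilter F) :
    ∃ b : StoneCech X, F ⊆ zeroSetTrace stoneCechUnit b := by
  have hne : (Filter.generate F).NeBot := Filter.generate_neBot_iff.2 fun t ht hfin =>
    hF.nonempty_of_mem (hF.sInter_mem hfin ht)
  obtain ⟨b, hb⟩ := exists_clusterPt_of_compactSpace
    (Filter.map (stoneCechUnit : X → StoneCech X) (Filter.generate F))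
  exact ⟨b, fun Z hZ => ⟨hF.isZeroSet Z hZ, mem_closure_iff_clusterPt.2
    (hb.mono (le_principal_iff.2 (image_mem_map (Filter.mem_generate_of_mem hZ))))⟩⟩

theorem IsZFilter.exists_isZUltrafilter [T35Space X] {F : Set (Set X)} (hF : IsZFilter F) :
    ∃ U, IsZUltrafilter U ∧ F ⊆ U :=
  let ⟨b, hb⟩ := hF.exists_subset_zeroSetTrace
  ⟨_, isZUltrafilter_zeroSetTrace_stoneCech b, hb⟩

theorem IsZUltrafilter.exists_eq_zeroSetTrace [T35Space X] {U : Set (Set X)} (hU : IsZUltrafilter U) :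
    ∃ b : StoneCech X, U = zeroSetTrace stoneCechUnit b :=
  let ⟨b, hb⟩ := hU.isZFilter.exists_subset_zeroSetTrace
  ⟨b, hb.antisymm (hU.le_of_ge (isZUltrafilter_zeroSetTrace_stoneCech b).isZFilter hb)⟩

/-- Intersecting the members with `H` yields a base of hard zero sets, since closed subsets of hard
sets are hard. -/
theorem IsZUltrafilter.isHzUltrafilter {U : Set (Set X)} (hU : IsZUltrafilter U) {H : Set X}
    (hH : H ∈ U) (hard : IsHard H) : IsHzUltrafilter U := by
  refine ⟨⟨hU.isZFilter, fun Z hZ => ⟨Z ∩ H, hU.isZFilter.inter_mem _ hZ _ hH,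
    hard.mono ?_ inter_subset_right, inter_subset_left⟩⟩, fun V hV h => hU.le_of_ge hV.1 h⟩
  exact ((hU.isZFilter.isZeroSet Z hZ).inter (hU.isZFilter.isZeroSet H hH)).isClosed

theorem IsHzUltrafilter.exists_isHard {U : Set (Set X)} (hU : IsHzUltrafilter U) :
    ∃ H ∈ U, IsHard H :=
  let ⟨_, hZ⟩ := hU.prop.1.nonempty
  let ⟨H, hH, hard, _⟩ := hU.prop.2 _ hZ
  ⟨H, hH, hard⟩

/-- Any z-ultrafilter above `U` contains a hard member of `U`, hence is itself an hz-filter, and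
maximality of `U` gives equality. -/
theorem IsHzUltrafilter.isZUltrafilter [T35Space X] {U : Set (Set X)} (hU : IsHzUltrafilter U) :
    IsZUltrafilter U := by
  obtain ⟨V, hV, hUV⟩ := hU.prop.1.exists_isZUltrafilter
  obtain ⟨H, hH, hard⟩ := hU.exists_isHard
  rwa [hU.eq_of_le (hV.isHzUltrafilter (hUV hH) hard).prop hUV]

end StoneCechZ

/-! ### The equivalences of (A). -/

section Equivalences

variable {X : Type u} [TopologicalSpace X] {T : Type v} [TopologicalSpace T] {e : X → T}

theorem H2pcMapsExtend.isSEmbedded (h : H2pcMapsExtend.{u, v, w} e) : IsSEmbedded e := by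
  intro f hf
  -- `ULift` places the real line in the universe over which the target spaces range.
  have hτ : IsH2pc fun x => (ULift.up (f x) : ULift.{w} ℝ) := by
    refine ⟨continuous_uliftUp.comp hf.1, fun H hH => ?_⟩
    have hc : IsCompact (ULift.up '' closure (f '' H) : Set (ULift.{w} ℝ)) :=
      (Metric.isCompact_of_isClosed_isBounded isClosed_closure (hf.2 H hH).closure).image
        continuous_uliftUp
    refine hc.of_isClosed_subset isClosed_closure (closure_minimal ?_ hc.isClosed)
    rintro _ ⟨x, hx, rfl⟩
    exact ⟨f x, subset_closure ⟨x, hx, rfl⟩, rfl⟩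
  obtain ⟨τ, hτ, hτe⟩ := h (ULift.{w} ℝ) _ hτ
  exact ⟨fun t => (τ t).down, continuous_uliftDown.comp hτ, fun x => by simp [hτe]⟩

theorem IsSEmbedded.disjointZeroSetClosures (h : IsSEmbedded e) : DisjointZeroSetClosures e := by
  refine fun _ _ h₁ h₂ hd => (h₁.completelySeparated h₂ hd).disjoint_closure fun f hf =>
    h f ⟨f.continuous, fun H _ => (Metric.isBounded_Icc (0 : ℝ) 1).subset ?_⟩
  rintro _ ⟨x, -, rfl⟩
  exact hf x

theorem ZeroSetClosuresInter.pointsAreUniqueLimits [T35Space T] (he : IsDenseInducing e)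
    (hp : ∀ p : T, p ∉ range e → ∃ H : Set X, IsHard H ∧ p ∈ closure (e '' H))
    [T35Space X] (h : ZeroSetClosuresInter e) : PointsAreUniqueLimits e := by
  intro p
  have hU := h.isZUltrafilter_zeroSetTrace he p
  refine ⟨zeroSetTrace e p, ?_, convergesIn_zeroSetTrace he p, fun V hV hVp =>
    hV.eq_of_le hU.isZFilter (hV.isZFilter.subset_zeroSetTrace_of_convergesIn hVp)⟩
  by_cases hpr : p ∈ range e
  · obtain ⟨x, rfl⟩ := hpr
    exact Or.inl ⟨hU, x, fun Z hZ => he.mem_of_mem_closure_image hZ.1.isClosed hZ.2⟩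
  · obtain ⟨H, hH, hpH⟩ := hp p hpr
    obtain ⟨Z, hZ, hard, hpZ⟩ := exists_isHard_isZeroSet he hpr hH hpH
    exact Or.inr (hU.isHzUltrafilter ⟨hZ, hpZ⟩ hard)

theorem PointsAreUniqueLimits.disjointZeroSetClosures [T35Space T] (he : IsDenseInducing e)
    [T35Space X] (h : PointsAreUniqueLimits e) : DisjointZeroSetClosures e := by
  intro Z₁ Z₂ h₁ h₂ hd
  rw [eq_empty_iff_forall_notMem]
  rintro p ⟨hp₁, hp₂⟩
  obtain ⟨U, hU', -, hU⟩ := h p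
  have hUF : IsZFilter U := (hU'.elim (·.1) (·.isZUltrafilter)).isZFilter
  have key : ∀ Z : Set X, IsZeroSet Z → p ∈ closure (e '' Z) → Z ∈ U := by
    intro Z hZ hpZ
    -- The z-filter generated by `Z` and the neighbourhoods of `p`: any z-ultrafilter above it
    -- converges to `p`, so uniqueness identifies it with `U`.
    have hF : IsZFilter {W : Set X | IsZeroSet W ∧ ∃ N ∈ 𝓝 p, e ⁻¹' N ∩ Z ⊆ W} := by
      refine ⟨fun W hW => hW.1, ⟨Z, hZ, univ, univ_mem, inter_subset_right⟩, ?_, ?_, ?_⟩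
      · rintro ⟨-, N, hN, hNe⟩
        obtain ⟨_, hy, x, hx, rfl⟩ := mem_closure_iff_nhds.1 hpZ N hN
        exact hNe ⟨hy, hx⟩
      · rintro W₁ ⟨hW₁, N₁, hN₁, h₁⟩ W₂ ⟨hW₂, N₂, hN₂, h₂⟩
        exact ⟨hW₁.inter hW₂, N₁ ∩ N₂, inter_mem hN₁ hN₂, fun x hx =>
          ⟨h₁ ⟨hx.1.1, hx.2⟩, h₂ ⟨hx.1.2, hx.2⟩⟩⟩
      · rintro W ⟨-, N, hN, hNW⟩ W' hW' hs
        exact ⟨hW', N, hN, hNW.trans hs⟩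
    obtain ⟨V, hV, hFV⟩ := hF.exists_isZUltrafilter
    rw [← hU V hV ?_]
    · exact hFV ⟨hZ, univ, univ_mem, inter_subset_right⟩
    · intro N hN
      obtain ⟨W, hW, hWN, M, hM, hMW⟩ := exists_mem_zeroSetTrace he hN
      exact ⟨W, hFV ⟨hW.1, M, hM, inter_subset_left.trans hMW⟩, hWN⟩
  exact hUF.empty_notMem (hd ▸ hUF.inter_mem _ (key _ h₁ hp₁) _ (key _ h₂ hp₂))

theorem DisjointZeroSetClosures.h2pcMapsExtend (he : IsDenseInducing e)
    (hp : ∀ p : T, p ∉ range e → ∃ H : Set X, IsHard H ∧ p ∈ closure (e '' H))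
    (h : DisjointZeroSetClosures e) : H2pcMapsExtend.{u, v, w} e := by
  intro Y _ _ τ hτ
  have hlim : ∀ p : T, ∃ y, Tendsto τ (comap e (𝓝 p)) (𝓝 y) := by
    intro p
    by_cases hpr : p ∈ range e
    · obtain ⟨x, rfl⟩ := hpr
      exact ⟨τ x, by rw [← he.isInducing.nhds_eq_comap]; exact hτ.1.continuousAt⟩
    obtain ⟨H, hH, hpH⟩ := hp p hpr
    have hne : (comap e (𝓝 p) ⊓ 𝓟 H).NeBot := by
      rw [inf_neBot_iff]
      rintro _ ⟨M, hM, hMs⟩ _ hs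
      obtain ⟨_, hz, x, hx, rfl⟩ := mem_closure_iff_nhds.1 hpH M hM
      exact ⟨x, hMs hz, hs hx⟩
    -- The candidate limit is a cluster point of `τ` along `H` near `p`; it exists because the
    -- closure of `τ(H)` is compact.
    obtain ⟨y, -, hy⟩ := hτ.2 H hH (f := map τ (comap e (𝓝 p) ⊓ 𝓟 H))
      (le_principal_iff.2 (mem_of_superset (image_mem_map (mem_inf_of_right (mem_principal_self H)))
        subset_closure))
    refine ⟨y, fun N hN => ?_⟩
    obtain ⟨g, hg, -, hgy, hgN⟩ := exists_separating_function hN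
    have hgτ : Continuous fun x => g (τ x) := hg.comp hτ.1
    have hd := h _ _ (isZeroSet_le hgτ (1 / 3)) (isZeroSet_ge hgτ (2 / 3)) (by
      rw [eq_empty_iff_forall_notMem]
      rintro x ⟨h₁, h₂⟩
      simp only [mem_ofPred_eq] at h₁ h₂
      linarith)
    -- The cluster point places `p` in the closure of the sublevel set, so by disjointness `p` is
    -- off the closure of the superlevel set. Near `p` the map then takes values only where `g <
    -- 2/3`, that is, inside `N`.
    have hp₁ : p ∈ closure (e '' {x | g (τ x) ≤ 1 / 3}) := by
      rw [mem_closure_iff_nhds]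
      intro M hM
      have hy' : {y | g y ≤ 1 / 3} ∈ 𝓝 y :=
        (hg.tendsto y).eventually_le_const (by norm_num [hgy])
      obtain ⟨_, hz, x, hx, rfl⟩ := clusterPt_iff_nonempty.1 hy hy'
        (image_mem_map (mem_inf_of_left (preimage_mem_comap hM)))
      exact ⟨e x, hx, x, hz, rfl⟩
    have hp₂ : p ∉ closure (e '' {x | 2 / 3 ≤ g (τ x)}) := fun hp₂ =>
      (hd ▸ ⟨hp₁, hp₂⟩ : p ∈ (∅ : Set T))
    refine mem_map.2 (mem_of_superset (preimage_mem_comap (isClosed_closure.isOpen_compl.mem_nhds hp₂)) ?_)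
    intro x hx
    by_contra hxN
    refine hx (subset_closure ⟨x, ?_, rfl⟩)
    have := hgN _ hxN
    simp only [mem_ofPred_eq, this]
    norm_num
  exact ⟨he.extend τ, he.continuous_extend hlim, he.extend_eq' hlim⟩

theorem tfae_h2pcMapsExtend [T35Space X] [T35Space T] (he : IsDenseInducing e)
    (hp : ∀ p : T, p ∉ range e → ∃ H : Set X, IsHard H ∧ p ∈ closure (e '' H)) :
    List.TFAE [H2pcMapsExtend.{u, v, w} e, IsSEmbedded e, DisjointZeroSetClosures e,
      ZeroSetClosuresInter e, PointsAreUniqueLimits e] := by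
  tfae_have 1 → 2 := H2pcMapsExtend.isSEmbedded
  tfae_have 2 → 3 := IsSEmbedded.disjointZeroSetClosures
  tfae_have 3 → 4 := DisjointZeroSetClosures.zeroSetClosuresInter he
  tfae_have 4 → 5 := ZeroSetClosuresInter.pointsAreUniqueLimits he hp
  tfae_have 5 → 3 := PointsAreUniqueLimits.disjointZeroSetClosures he
  tfae_have 3 → 1 := DisjointZeroSetClosures.h2pcMapsExtend he hp
  tfae_finish

end Equivalences

/-! ### Realcompact subsets and unbounded functions. -/

section Realcompact

theorem IsCompact.isRealcompactSpace {X : Type u} [TopologicalSpace X] {K : Set X}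
    (hK : IsCompact K) : IsRealcompactSpace K := by
  intro S hS _ hfip
  have := isCompact_iff_compactSpace.1 hK
  have hne : (generate S).NeBot := generate_neBot_iff.2 fun t ht hfin => hfip t ht hfin
  obtain ⟨x, hx⟩ := exists_clusterPt_of_compactSpace (generate S)
  exact ⟨x, fun A hA => (hS A hA).closure_eq ▸
    hx.mem_closure_of_mem _ (mem_generate_of_mem hA)⟩

theorem IsRealcompactSpace.of_homeomorph {X Y : Type u} [TopologicalSpace X] [TopologicalSpace Y]
    (hX : IsRealcompactSpace X) (φ : X ≃ₜ Y) : IsRealcompactSpace Y := by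
  intro S hS hst hfip
  obtain ⟨x, hx⟩ := hX ((fun A => φ ⁻¹' A) '' S)
    (by rintro _ ⟨A, hA, rfl⟩; exact (hS A hA).preimage φ.continuous)
    (fun f => by
      obtain ⟨A, hA, hb⟩ := hst (f.comp ⟨φ.symm, φ.symm.continuous⟩)
      refine ⟨_, ⟨A, hA, rfl⟩, hb.subset ?_⟩
      rintro _ ⟨x, hx, rfl⟩
      exact ⟨φ x, hx, by simp⟩)
    (fun s hs hfin => by
      obtain ⟨t, htS, htf, rfl⟩ := (exists_subset_image_finite_and (p := (· = s))).1 ⟨s, hs, hfin, rfl⟩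
      obtain ⟨y, hy⟩ := hfip t htS htf
      refine ⟨φ.symm y, ?_⟩
      rintro _ ⟨A, hA, rfl⟩
      simpa using hy A hA)
  exact ⟨φ x, fun A hA => hx _ ⟨A, hA, rfl⟩⟩

theorem continuous_mul_of_continuousOn {X : Type u} [TopologicalSpace X] {G F : X → ℝ}
    (hG : Continuous G) {U C : Set X} (hU : IsOpen U) (hF : ContinuousOn F U) (hC : IsClosed C)
    (hCU : C ⊆ U) (hGC : ∀ x ∉ C, G x = 0) : Continuous fun x => G x * F x := by
  rw [continuous_iff_continuousAt]
  intro x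
  by_cases hx : x ∈ U
  · exact hG.continuousAt.mul (hF.continuousAt (hU.mem_nhds hx))
  · have : (fun _ => 0) =ᶠ[𝓝 x] fun x => G x * F x := by
      filter_upwards [hC.isOpen_compl.mem_nhds fun h => hx (hCU h)] with y hy
      simp [hGC y hy]
    exact continuousAt_const.congr this

open Classical in
theorem continuousOn_dite {X : Type u} [TopologicalSpace X] {M : Set X} {f : M → ℝ}
    (hf : Continuous f) : ContinuousOn (fun x => if h : x ∈ M then f ⟨x, h⟩ else 0) M := by
  rw [continuousOn_iff_continuous_domRestrict]
  convert hf with x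
  simp

open Classical in
/-- If a realcompact subset of `A` contains the trace of a neighbourhood of `q ∉ A`, then some
continuous function on `A` is unbounded on every neighbourhood of `q`. -/
theorem exists_unbounded_of_isRealcompactSpace {A : Type u} {B : Type v} [TopologicalSpace A]
    [TopologicalSpace B] [T35Space B] {i : A → B} (hi : IsDenseInducing i) {M : Set A}
    (hM : IsRealcompactSpace M) {O : Set B} (hO : IsOpen O) (hOM : i ⁻¹' O ⊆ M) {q : B}
    (hq : q ∈ O) (hqi : q ∉ range i) :
    ∃ h : C(A, ℝ), ∀ N ∈ 𝓝 q, ¬ Bornology.IsBounded (h '' (i ⁻¹' N)) := by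
  have hic := hi.isInducing.continuous
  -- The traces on `M` of the closed neighbourhoods of `q` have the finite intersection property but
  -- no common point. Realcompactness of `M` therefore denies stability, giving `f` on `M` unbounded
  -- on each of them.
  let S : Set (Set M) := {s | ∃ N ∈ 𝓝 q, IsClosed N ∧ s = (fun x : M => i x) ⁻¹' N}
  have hempty : ¬ (⋂₀ S).Nonempty := by
    rintro ⟨x, hx⟩
    obtain ⟨N, hN, hNc, hNs⟩ := exists_mem_nhds_isClosed_subset
      (isOpen_compl_singleton.mem_nhds (fun h => hqi ⟨x, h.symm⟩ : q ∈ ({i x}ᶜ : Set B)))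
    exact hNs (hx _ ⟨N, hN, hNc, rfl⟩) rfl
  have hne : (comap (fun x : M => i x) (𝓝 q)).NeBot := by
    rw [comap_neBot_iff]
    intro t ht
    obtain ⟨_, hy, x, rfl⟩ := mem_closure_iff_nhds.1 (hi.dense q) _
      (inter_mem ht (hO.mem_nhds hq))
    exact ⟨⟨x, hOM hy.2⟩, hy.1⟩
  have hst : ¬ IsStableFamily S := by
    refine fun hst => hempty (hM S ?_ hst ?_)
    · rintro _ ⟨N, -, hNc, rfl⟩
      exact hNc.preimage (hic.comp continuous_subtype_val)
    · intro s hs hfin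
      refine nonempty_of_mem ((sInter_mem hfin).2 fun t ht => ?_ :
        _ ∈ comap (fun x : M => i x) (𝓝 q))
      obtain ⟨N, hN, -, rfl⟩ := hs ht
      exact preimage_mem_comap hN
  simp only [IsStableFamily, not_forall, not_exists, not_and] at hst
  obtain ⟨f, hf⟩ := hst
  obtain ⟨O', hO', hO'c, hO's⟩ := exists_mem_nhds_isClosed_subset (hO.mem_nhds hq)
  obtain ⟨g, hg, -, hgq, hgO⟩ := exists_separating_function hO'
  -- The cutoff `1 - g` vanishes outside `O'`, so its product with `f` extends by zero to all of
  -- `A`. It is at least `1/2` near `q`, whence the bound `2 * c` for `f` below.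
  have hcont := continuous_mul_of_continuousOn (G := fun a => 1 - g (i a))
    (continuous_const.sub (hg.comp hic)) (hO.preimage hic)
    ((continuousOn_dite f.continuous).mono hOM) (hO'c.preimage hic) (preimage_mono hO's)
    (fun x hx => by simp [hgO _ hx])
  refine ⟨⟨_, hcont⟩, fun N hN hb => ?_⟩
  obtain ⟨c, hc⟩ := isBounded_iff_forall_norm_le.1 hb
  have hg' : {b | g b ≤ 1 / 2} ∈ 𝓝 q := (hg.tendsto q).eventually_le_const (by norm_num [hgq])
  obtain ⟨N', hN', hN'c, hN's⟩ := exists_mem_nhds_isClosed_subset (inter_mem hN hg')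
  refine hf _ ⟨N', hN', hN'c, rfl⟩ (isBounded_iff_forall_norm_le.2 ⟨2 * c, ?_⟩)
  rintro _ ⟨x, hx, rfl⟩
  have h1 := hc _ ⟨x, (hN's hx).1, rfl⟩
  have h2 : g (i x) ≤ 1 / 2 := (hN's hx).2
  simp only [ContinuousMap.coe_mk, Subtype.coe_prop, dite_true, Subtype.coe_eta, norm_mul] at h1
  have h3 : 1 / 2 ≤ ‖1 - g (i x)‖ := (by linarith : 1 / 2 ≤ 1 - g (i x)).trans (Real.le_norm_self _)
  nlinarith [norm_nonneg (f x)]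

end Realcompact

/-! ### Hard sets and the closure of the Hewitt remainder. -/

section HewittRemainder

variable {X : Type u} [TopologicalSpace X]

variable (X) in
/-- The set of all points of the Stone–Čech remainder near which every continuous real-valued
function on `X` is bounded, i.e. the remainder of the Hewitt realcompactification. -/
def hewittRemainder : Set (StoneCech X) :=
  {q | q ∉ range stoneCechUnit ∧
    ∀ f : C(X, ℝ), ∃ N ∈ 𝓝 q, Bornology.IsBounded (f '' (stoneCechUnit ⁻¹' N))}

theorem notMem_closure_hewittRemainder_of_isHard [T35Space X] {H : Set X} (hH : IsHard H)
    {q : StoneCech X} (hq : q ∉ range (stoneCechUnit : X → StoneCech X))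
    (hqH : q ∈ closure (stoneCechUnit '' H)) : q ∉ closure (hewittRemainder X) := by
  obtain ⟨P, hP, f, hf, h0, h1⟩ :=
    exists_function_of_mem_closure_isHard isDenseInducing_stoneCechUnit hq hH hqH
  obtain ⟨f', hf', hfe⟩ := exists_stoneCech_extension f.continuous hf
  have hq0 : f' q = 0 := closure_minimal (by rintro _ ⟨x, hx, rfl⟩; simpa [hfe] using hx)
    (isClosed_singleton.preimage hf' : IsClosed (f' ⁻¹' {0})) h0
  intro hcl
  -- The open set `f' < 1` has its trace inside the realcompact set `P`. A remainder point there
  -- would have an unbounded function near it.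
  obtain ⟨u, hu, huQ⟩ := mem_closure_iff.1 hcl _ (isOpen_Iio.preimage hf' : IsOpen (f' ⁻¹' Iio 1))
    (by simp [hq0])
  obtain ⟨h, hh⟩ := exists_unbounded_of_isRealcompactSpace isDenseInducing_stoneCechUnit hP
    (isOpen_Iio.preimage hf') (fun x hx => by_contra fun hxP => by
      simp [hfe, h1 x hxP] at hx) hu huQ.1
  obtain ⟨N, hN, hb⟩ := huQ.2 h
  exact hh N hN hb

/-- A stable family clusters at some `q` in `βX`. If `q` is in `X`, it is the common point.
Otherwise some `h` is unbounded near `q`, so the extension `r` of `1 / (1 + |h|)` vanishes at `q`;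
yet `h` is bounded on some member of the family, which keeps `r` away from zero on a closure
containing `q`. -/
theorem isRealcompactSpace_of_closure_disjoint [T35Space X] {P : Set X} (hP : IsClosed P)
    (hd : ∀ q ∈ closure (stoneCechUnit '' P), q ∉ hewittRemainder X) : IsRealcompactSpace P := by
  intro S hS hst hfip
  let j : P → StoneCech X := fun x => stoneCechUnit x
  have hj : IsInducing j := isInducing_stoneCechUnit.comp IsInducing.subtypeVal
  have hne : (generate S).NeBot := generate_neBot_iff.2 fun t ht hfin => hfip t ht hfin
  obtain ⟨q, hq⟩ := exists_clusterPt_of_compactSpace (map j (generate S))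
  have hqS : ∀ A ∈ S, q ∈ closure (j '' A) := fun A hA =>
    hq.mem_closure_of_mem _ (image_mem_map (mem_generate_of_mem hA))
  have hqP : q ∈ closure (stoneCechUnit '' P) := by
    refine hq.mem_closure_of_mem _ (mem_of_superset (image_mem_map univ_mem) ?_)
    rintro _ ⟨x, -, rfl⟩
    exact ⟨x, x.2, rfl⟩
  by_cases hqr : q ∈ range (stoneCechUnit : X → StoneCech X)
  · obtain ⟨x, rfl⟩ := hqr
    have hx := isDenseInducing_stoneCechUnit.mem_of_mem_closure_image hP hqP
    refine ⟨⟨x, hx⟩, fun A hA => ?_⟩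
    rw [← (hS A hA).closure_eq, hj.closure_eq_preimage_closure_image]
    exact hqS A hA
  · exfalso
    have hqQ : ¬ ∀ f : C(X, ℝ), ∃ N ∈ 𝓝 q,
        Bornology.IsBounded (f '' (stoneCechUnit ⁻¹' N)) := fun h => hd q hqP ⟨hqr, h⟩
    simp only [not_forall, not_exists, not_and] at hqQ
    obtain ⟨h, hh⟩ := hqQ
    have hpos : ∀ x, 0 < 1 + |h x| := fun x => by positivity
    obtain ⟨r, hr, hre⟩ := exists_stoneCech_extension (f := fun x => (1 + |h x|)⁻¹)
      ((by fun_prop : Continuous fun x => 1 + |h x|).inv₀ fun x => (hpos x).ne')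
      (fun x => ⟨(inv_pos.2 (hpos x)).le, inv_le_one_of_one_le₀ (by linarith [abs_nonneg (h x)])⟩)
    have hrq : r q ≤ 0 := by
      by_contra hc
      push Not at hc
      refine hh _ ((isOpen_Ioi.preimage hr).mem_nhds (half_lt_self hc : q ∈ r ⁻¹' Ioi (r q / 2)))
        (isBounded_iff_forall_norm_le.2 ⟨(r q / 2)⁻¹, ?_⟩)
      rintro _ ⟨x, hx, rfl⟩
      have hx : r q / 2 < r (stoneCechUnit x) := hx
      rw [hre] at hx
      have := (lt_inv_comm₀ (by positivity) (hpos x)).1 hx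
      rw [Real.norm_eq_abs]
      linarith
    obtain ⟨A, hA, hb⟩ := hst (h.comp ⟨Subtype.val, continuous_subtype_val⟩)
    obtain ⟨c, hc⟩ := isBounded_iff_forall_norm_le.1 hb
    have hsub : closure (j '' A) ⊆ r ⁻¹' Ici (1 + |c|)⁻¹ := by
      refine closure_minimal ?_ (isClosed_Ici.preimage hr)
      rintro _ ⟨x, hx, rfl⟩
      have h1 := hc _ ⟨x, hx, rfl⟩
      simp only [ContinuousMap.comp_apply, ContinuousMap.coe_mk, Real.norm_eq_abs] at h1
      simp only [mem_preimage, mem_Ici, j, hre]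
      exact inv_anti₀ (hpos _) (by linarith [le_abs_self c])
    have h1 : (1 + |c|)⁻¹ ≤ r q := hsub (hqS A hA)
    have h2 : 0 < (1 + |c|)⁻¹ := by positivity
    linarith

/-- With `g` separating `q` from the remainder, the set `g ≤ 1/3` is completely separated from the
complement of `g ≤ 2/3`, which is realcompact because its closure misses the remainder. -/
theorem exists_isHard_of_notMem_closure_hewittRemainder [T35Space X] {q : StoneCech X}
    (hq : q ∉ closure (hewittRemainder X)) :
    ∃ H ∈ zeroSetTrace (stoneCechUnit : X → StoneCech X) q, IsHard H := by
  obtain ⟨g, hg, -, hgq, hg1⟩ := exists_separating_function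
    (isClosed_closure.isOpen_compl.mem_nhds hq)
  have hgj : Continuous fun x : X => g (stoneCechUnit x) := hg.comp continuous_stoneCechUnit
  have hN : {b | g b ≤ 1 / 3} ∈ 𝓝 q := (hg.tendsto q).eventually_le_const (by norm_num [hgq])
  have hZ := isZeroSet_le hgj (1 / 3)
  refine ⟨_, ⟨hZ, isDenseInducing_stoneCechUnit.mem_closure_image_of_mem_nhds hN⟩,
    isHard_of_completelySeparated (P := {x | g (stoneCechUnit x) ≤ 2 / 3}) hZ.isClosed ?_ ?_⟩
  · refine isRealcompactSpace_of_closure_disjoint (isZeroSet_le hgj _).isClosed fun b hb hbQ => ?_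
    have h1 : g b ≤ 2 / 3 := closure_minimal (by rintro _ ⟨x, hx, rfl⟩; exact hx)
      (isClosed_Iic.preimage hg : IsClosed (g ⁻¹' Iic (2 / 3))) hb
    have h2 := hg1 b fun h => h (subset_closure hbQ)
    norm_num [h2] at h1
  · refine (hZ.completelySeparated (isZeroSet_ge hgj (2 / 3)) ?_).mono subset_rfl ?_
    · rw [eq_empty_iff_forall_notMem]
      rintro x ⟨h₁, h₂⟩
      simp only [mem_ofPred_eq] at h₁ h₂
      linarith
    · intro x hx
      simp only [mem_compl_iff, mem_ofPred_eq, not_le] at hx ⊢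
      exact hx.le

end HewittRemainder

/-! ### The space `δX` as a subspace of `βX`. -/

section DeltaExt

theorem zeroSetTrace_injective {X : Type u} {T : Type v} [TopologicalSpace X] [TopologicalSpace T]
    [T35Space T] {e : X → T} (he : IsDenseInducing e) : Function.Injective (zeroSetTrace e) := by
  intro b b' h
  by_contra hne
  obtain ⟨N, hN, hNc, hNs⟩ := exists_mem_nhds_isClosed_subset
    (isOpen_compl_singleton.mem_nhds (hne : b ∈ ({b'}ᶜ : Set T)))
  obtain ⟨Z, hZ, hZN, -⟩ := exists_mem_zeroSetTrace he hN
  rw [h] at hZ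
  exact hNs (closure_minimal hZN hNc hZ.2) rfl

theorem zeroSetTrace_apply {X : Type u} {T : Type v} [TopologicalSpace X] [TopologicalSpace T] {e : X → T} (he : IsDenseInducing e)
    (x : X) : zeroSetTrace e (e x) = zeroSetsAt x := by
  ext Z
  exact and_congr_right fun hZ => ⟨he.mem_of_mem_closure_image hZ.isClosed,
    fun hx => subset_closure ⟨x, hx, rfl⟩⟩

theorem DeltaExt.mem_range_of_or_exists_isHard {X : Type u} [TopologicalSpace X]
    (p : DeltaExt X) : p ∈ range (DeltaExt.of X) ∨ ∃ H ∈ p.1, IsHard H := by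
  obtain ⟨hp, x, hx⟩ | hp := p.2
  · refine Or.inl ⟨x, Subtype.ext ?_⟩
    exact (hp.eq_of_le (isFixedZUltrafilter_zeroSetsAt x).1.isZFilter
      fun Z hZ => ⟨hp.isZFilter.isZeroSet Z hZ, hx Z hZ⟩).symm
  · exact Or.inr hp.exists_isHard

variable {X : Type u} [TopologicalSpace X] [T35Space X]

theorem DeltaExt.isZUltrafilter (p : DeltaExt X) : IsZUltrafilter p.1 :=
  p.2.elim (·.1) (·.isZUltrafilter)

/-- The limit in the Stone–Čech compactification of a point of `DeltaExt X`. -/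
noncomputable def DeltaExt.limit (p : DeltaExt X) : StoneCech X :=
  p.isZUltrafilter.exists_eq_zeroSetTrace.choose

theorem DeltaExt.val_eq_zeroSetTrace_limit (p : DeltaExt X) :
    p.1 = zeroSetTrace stoneCechUnit p.limit :=
  p.isZUltrafilter.exists_eq_zeroSetTrace.choose_spec

theorem DeltaExt.mem_iff {p : DeltaExt X} {Z : Set X} (hZ : IsZeroSet Z) :
    Z ∈ p.1 ↔ p.limit ∈ closure (stoneCechUnit '' Z) := by
  rw [p.val_eq_zeroSetTrace_limit]
  exact and_iff_right hZ

theorem DeltaExt.limit_eq_of_val_eq {p : DeltaExt X} {b : StoneCech X}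
    (h : p.1 = zeroSetTrace stoneCechUnit b) : p.limit = b :=
  zeroSetTrace_injective isDenseInducing_stoneCechUnit (p.val_eq_zeroSetTrace_limit ▸ h)

theorem DeltaExt.limit_of (x : X) : (DeltaExt.of X x).limit = stoneCechUnit x :=
  DeltaExt.limit_eq_of_val_eq (zeroSetTrace_apply isDenseInducing_stoneCechUnit x).symm

theorem DeltaExt.isEmbedding_limit :
    IsEmbedding (DeltaExt.limit : DeltaExt X → StoneCech X) := by
  have hd : IsDenseInducing (stoneCechUnit : X → StoneCech X) := isDenseInducing_stoneCechUnit
  refine ⟨⟨le_antisymm ?_ (le_generateFrom ?_)⟩, fun p q h => Subtype.ext ?_⟩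
  -- A neighbourhood of `p.limit` is shrunk to the complement of a zero-set closure: the basic open
  -- set given by `1/2 ≤ g` works.
  · rw [← continuous_iff_le_induced, continuous_iff_continuousAt]
    intro p N hN
    obtain ⟨g, hg, -, hgp, hgN⟩ := exists_separating_function hN
    have hgj : Continuous fun x : X => g (stoneCechUnit x) := hg.comp continuous_stoneCechUnit
    have hZ := isZeroSet_ge hgj (1 / 2)
    have hopen : IsOpen ({q : DeltaExt X | {x | 1 / 2 ≤ g (stoneCechUnit x)} ∈ q.1}ᶜ) :=
      TopologicalSpace.isOpen_generateFrom_of_mem ⟨_, hZ, rfl⟩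
    refine mem_map.2 (mem_of_superset (hopen.mem_nhds ?_) fun q hq => ?_)
    · intro hmem
      have : 1 / 2 ≤ g p.limit := closure_minimal (by rintro _ ⟨x, hx, rfl⟩; exact hx)
        (isClosed_Ici.preimage hg : IsClosed (g ⁻¹' Ici (1 / 2))) ((mem_iff hZ).1 hmem)
      norm_num [hgp] at this
    · by_contra hqN
      have hq1 : {b | 1 / 2 ≤ g b} ∈ 𝓝 q.limit :=
        (hg.tendsto _).eventually_const_le (by norm_num [hgN _ hqN])
      exact hq ((mem_iff hZ).2 (hd.mem_closure_image_of_mem_nhds hq1))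
  · rintro _ ⟨Z, hZ, rfl⟩
    refine ⟨(closure (stoneCechUnit '' Z))ᶜ, isClosed_closure.isOpen_compl, ?_⟩
    ext p
    simp only [mem_preimage, mem_compl_iff, mem_ofPred_eq, mem_iff hZ]
  · rw [p.val_eq_zeroSetTrace_limit, q.val_eq_zeroSetTrace_limit, h]

instance DeltaExt.instT35Space : T35Space (DeltaExt X) :=
  DeltaExt.isEmbedding_limit.t35Space

theorem DeltaExt.isDenseEmbedding_limit :
    IsDenseEmbedding (DeltaExt.limit : DeltaExt X → StoneCech X) where
  toIsInducing := isEmbedding_limit.isInducing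
  dense := denseRange_stoneCechUnit.mono (by
    rintro _ ⟨x, rfl⟩
    exact ⟨_, limit_of x⟩)
  injective := isEmbedding_limit.injective

theorem DeltaExt.isDenseEmbedding_of : IsDenseEmbedding (DeltaExt.of X) := by
  have hcomp : DeltaExt.limit ∘ DeltaExt.of X = stoneCechUnit := funext limit_of
  have hemb : IsEmbedding (DeltaExt.of X) :=
    isEmbedding_limit.of_comp_iff.1 (hcomp ▸ isEmbedding_stoneCechUnit)
  refine ⟨⟨hemb.isInducing, fun p => ?_⟩, hemb.injective⟩
  rw [isEmbedding_limit.isInducing.closure_eq_preimage_closure_image, ← range_comp, hcomp]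
  exact denseRange_stoneCechUnit _

theorem DeltaExt.limit_mem_closure_iff {p : DeltaExt X} {H : Set X} :
    p.limit ∈ closure (stoneCechUnit '' H) ↔ p ∈ closure (DeltaExt.of X '' H) := by
  rw [isEmbedding_limit.isInducing.closure_eq_preimage_closure_image, mem_preimage, image_image]
  simp_rw [limit_of]

theorem DeltaExt.exists_isHard_mem_closure {p : DeltaExt X} (hp : p ∉ range (DeltaExt.of X)) :
    ∃ H : Set X, IsHard H ∧ p ∈ closure (DeltaExt.of X '' H) := by
  obtain ⟨H, hH, hard⟩ := p.mem_range_of_or_exists_isHard.resolve_left hp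
  exact ⟨H, hard, limit_mem_closure_iff.1 ((mem_iff (p.isZUltrafilter.isZFilter.isZeroSet H hH)).1 hH)⟩

theorem DeltaExt.disjointZeroSetClosures_of : DisjointZeroSetClosures (DeltaExt.of X) := by
  intro Z₁ Z₂ h₁ h₂ hd
  rw [eq_empty_iff_forall_notMem]
  rintro p ⟨hp₁, hp₂⟩
  exact (disjointZeroSetClosures_stoneCechUnit Z₁ Z₂ h₁ h₂ hd ▸
    ⟨limit_mem_closure_iff.2 hp₁, limit_mem_closure_iff.2 hp₂⟩ : p.limit ∈ (∅ : Set _))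

theorem DeltaExt.convergesIn_self (p : DeltaExt X) : ConvergesIn (DeltaExt.of X) p.1 p := by
  have : p.1 = zeroSetTrace (DeltaExt.of X) p := by
    rw [p.val_eq_zeroSetTrace_limit]
    ext Z
    exact and_congr_right fun _ => limit_mem_closure_iff
  rw [this]
  exact convergesIn_zeroSetTrace isDenseEmbedding_of.toIsDenseInducing p

theorem DeltaExt.exists_limit_eq {q : StoneCech X} (hq : q ∉ closure (hewittRemainder X)) :
    ∃ p : DeltaExt X, p.limit = q := by
  obtain ⟨H, hH, hard⟩ := exists_isHard_of_notMem_closure_hewittRemainder hq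
  exact ⟨⟨_, Or.inr ((isZUltrafilter_zeroSetTrace_stoneCech q).isHzUltrafilter hH hard)⟩,
    limit_eq_of_val_eq rfl⟩

theorem DeltaExt.notMem_range_limit {q : StoneCech X} (hq : q ∈ hewittRemainder X) :
    q ∉ range (DeltaExt.limit : DeltaExt X → StoneCech X) := by
  rintro ⟨p, rfl⟩
  obtain ⟨x, rfl⟩ | ⟨H, hH, hard⟩ := p.mem_range_of_or_exists_isHard
  · exact hq.1 ⟨x, (limit_of x).symm⟩
  · exact notMem_closure_hewittRemainder_of_isHard hard hq.1
      ((mem_iff (p.isZUltrafilter.isZFilter.isZeroSet H hH)).1 hH) (subset_closure hq)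

/-- Continuous functions on `DeltaExt X` are bounded near the points of the Hewitt remainder. -/
theorem DeltaExt.exists_bounded_near {q : StoneCech X} (hq : q ∈ hewittRemainder X)
    (h : C(DeltaExt X, ℝ)) :
    ∃ N ∈ 𝓝 q, Bornology.IsBounded (h '' (DeltaExt.limit ⁻¹' N)) := by
  have hof : IsDenseEmbedding (DeltaExt.of X) := isDenseEmbedding_of
  obtain ⟨N, hN, hb⟩ := hq.2 (h.comp ⟨DeltaExt.of X, hof.isInducing.continuous⟩)
  refine ⟨interior N, interior_mem_nhds.2 hN, hb.closure.subset ?_⟩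
  rintro _ ⟨p, hp, rfl⟩
  have h1 := hof.toIsDenseInducing.mem_closure_image_of_mem_nhds
    ((isOpen_interior.preimage isEmbedding_limit.continuous).mem_nhds hp)
  refine closure_mono ?_ (image_closure_subset_closure_image h.continuous ⟨p, h1, rfl⟩)
  rintro _ ⟨_, ⟨x, hx, rfl⟩, rfl⟩
  refine ⟨x, ?_, rfl⟩
  have : (DeltaExt.of X x).limit ∈ interior N := hx
  rw [limit_of] at this
  exact (interior_subset this : stoneCechUnit x ∈ N)

/-- Otherwise the neighbourhood would reach a point of the Hewitt remainder, where realcompactness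
produces a function on `δX` unbounded near that point, against `exists_bounded_near`. -/
theorem DeltaExt.limit_notMem_of_isRealcompactSpace {p : DeltaExt X} {M : Set (DeltaExt X)}
    (hM : M ∈ 𝓝 p) (hMr : IsRealcompactSpace M) : p.limit ∉ closure (hewittRemainder X) := by
  rw [isEmbedding_limit.isInducing.nhds_eq_comap] at hM
  obtain ⟨O, hO, hOM⟩ := hM
  intro hcl
  obtain ⟨u, hu, huQ⟩ := mem_closure_iff_nhds.1 hcl _ (interior_mem_nhds.2 hO)
  obtain ⟨h, hh⟩ := exists_unbounded_of_isRealcompactSpace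
    isDenseEmbedding_limit.toIsDenseInducing hMr isOpen_interior
    ((preimage_mono interior_subset).trans hOM) hu (notMem_range_limit huQ)
  obtain ⟨N, hN, hb⟩ := exists_bounded_near huQ h
  exact hh N hN hb

theorem DeltaExt.exists_isCompact_mem_nhds_iff {p : DeltaExt X} :
    (∃ N ∈ 𝓝 p, IsCompact N) ↔ p.limit ∉ closure (hewittRemainder X) := by
  refine ⟨fun ⟨N, hN, hc⟩ => limit_notMem_of_isRealcompactSpace hN hc.isRealcompactSpace,
    fun hp => ?_⟩
  -- A closed neighbourhood in `βX` that avoids `cl Q` lies wholly in the image of `δX`, so its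
  -- preimage is compact.
  obtain ⟨C, hC, hCc, hCs⟩ := exists_mem_nhds_isClosed_subset
    (isClosed_closure.isOpen_compl.mem_nhds hp)
  exact ⟨DeltaExt.limit ⁻¹' C, isEmbedding_limit.continuous.continuousAt hC,
    (isEmbedding_limit.isInducing.isCompact_preimage_iff
      fun q hq => exists_limit_eq (hCs hq)).2 hCc.isCompact⟩

end DeltaExt

/-! ### Near pseudocompactness of `δX`. -/

section NearlyPseudocompact

theorem isRegularClosed_closure {X : Type u} [TopologicalSpace X] {U : Set X} (hU : IsOpen U) :
    IsRegularClosed (closure U) :=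
  (closure_minimal interior_subset isClosed_closure).antisymm
    (closure_mono (interior_maximal subset_closure hU))

theorem interior_inter_closure_compl {X : Type u} [TopologicalSpace X] (A : Set X) :
    interior (A ∩ closure Aᶜ) = ∅ := by
  rw [eq_empty_iff_forall_notMem]
  intro x hx
  obtain ⟨y, hy, hyA⟩ := mem_closure_iff.1 (interior_subset hx).2 _ isOpen_interior hx
  exact hyA (interior_subset hy).1

variable {X : Type u} [TopologicalSpace X]

variable (X) in
/-- The set of all points of `DeltaExt X` having compact neighbourhoods. -/
def DeltaExt.locallyCompactPoints : Set (DeltaExt X) :=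
  {p | ∃ N ∈ 𝓝 p, IsCompact N}

variable [T35Space X]

theorem DeltaExt.locallyCompactPoints_eq : DeltaExt.locallyCompactPoints X =
    DeltaExt.limit ⁻¹' (closure (hewittRemainder X))ᶜ :=
  ext fun _ => exists_isCompact_mem_nhds_iff

theorem DeltaExt.isOpen_locallyCompactPoints : IsOpen (DeltaExt.locallyCompactPoints X) := by
  rw [locallyCompactPoints_eq]
  exact isClosed_closure.isOpen_compl.preimage isEmbedding_limit.continuous

theorem DeltaExt.isAntiLocallyRealcompactSpace : IsAntiLocallyRealcompactSpace
    (closure (closure (DeltaExt.locallyCompactPoints X))ᶜ : Set (DeltaExt X)) := by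
  intro x N hN hNr
  obtain ⟨W, hW, hWN⟩ := mem_nhds_subtype _ _ _ |>.1 hN
  obtain ⟨z, hzW, hz⟩ := mem_closure_iff_nhds.1 x.2 _ (interior_mem_nhds.2 hW)
  -- The second piece is the closure of an open set, so `N` is a neighbourhood in `δX` itself of
  -- some point `z` of that open set.
  have hM : Subtype.val '' N ∈ 𝓝 z := by
    filter_upwards [isOpen_interior.mem_nhds hzW, isClosed_closure.isOpen_compl.mem_nhds hz]
      with y hyW hy
    have hyN : (⟨y, subset_closure hy⟩ :
        (closure (closure (DeltaExt.locallyCompactPoints X))ᶜ : Set (DeltaExt X))) ∈ N :=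
      hWN (interior_subset hyW : y ∈ W)
    exact ⟨_, hyN, rfl⟩
  have hlim := limit_notMem_of_isRealcompactSpace hM
    (hNr.of_homeomorph (IsEmbedding.subtypeVal.homeomorphImage N))
  exact hz (subset_closure (exists_isCompact_mem_nhds_iff.2 hlim))

/-- A function on `DeltaExt X` that is continuous on the closure of the locally compact points is
bounded above on the locally compact points. -/
theorem DeltaExt.exists_le_on_locallyCompactPoints {F : DeltaExt X → ℝ}
    (hF : ContinuousOn F (closure (DeltaExt.locallyCompactPoints X))) :
    ∃ n : ℕ, ∀ x ∈ DeltaExt.locallyCompactPoints X, F x ≤ n := by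
  by_contra hcon
  push Not at hcon
  choose x hxL hxF using hcon
  set L := DeltaExt.locallyCompactPoints X
  have hLo : IsOpen L := isOpen_locallyCompactPoints
  have hLeq : L = DeltaExt.limit ⁻¹' (closure (hewittRemainder X))ᶜ := locallyCompactPoints_eq
  have hFL : ContinuousOn F L := hF.mono subset_closure
  have hlim : Continuous (DeltaExt.limit : DeltaExt X → StoneCech X) := isEmbedding_limit.continuous
  have hdense : IsDenseInducing (DeltaExt.limit : DeltaExt X → StoneCech X) :=
    isDenseEmbedding_limit.toIsDenseInducing
  let U : ℕ → Set (DeltaExt X) := fun n => {y ∈ L | (n : ℝ) < F y}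
  have hUo : ∀ n, IsOpen (U n) := fun n => hFL.isOpen_inter_preimage hLo isOpen_Ioi
  -- This is where continuity on the whole closure of `L` matters: near `y` in `cl L`, `F < F y + 1`
  -- excludes all large `n`.
  have hUlf : LocallyFinite U := by
    intro y
    by_cases hy : y ∈ closure L
    · have hnhds := (hF y hy).eventually_lt_const (lt_add_one (F y))
      obtain ⟨m, hm⟩ := exists_nat_gt (F y + 1)
      refine ⟨_, mem_nhdsWithin_iff_eventually.1 hnhds, (finite_lt_nat m).subset ?_⟩
      rintro n ⟨z, ⟨hzL, hzn⟩, hz⟩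
      have := hz (subset_closure hzL)
      exact_mod_cast (hzn.trans this).trans hm
    · refine ⟨_, isClosed_closure.isOpen_compl.mem_nhds hy, ?_⟩
      convert finite_empty
      rw [eq_empty_iff_forall_notMem]
      rintro n ⟨z, ⟨hzL, -⟩, hz⟩
      exact hz (subset_closure hzL)
  have hE : ∀ n, ∃ E ∈ 𝓝 (x n).limit, IsClosed E ∧ E ⊆ (closure (hewittRemainder X))ᶜ ∧
      DeltaExt.limit ⁻¹' E ⊆ U n := by
    intro n
    have hUn := (hUo n).mem_nhds ⟨hxL n, hxF n⟩
    rw [isEmbedding_limit.isInducing.nhds_eq_comap] at hUn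
    obtain ⟨W, hW, hWU⟩ := hUn
    have hxn : (x n).limit ∈ (closure (hewittRemainder X))ᶜ := by
      have := hxL n
      rwa [hLeq] at this
    obtain ⟨E, hE, hEc, hEs⟩ := exists_mem_nhds_isClosed_subset
      (inter_mem hW (isClosed_closure.isOpen_compl.mem_nhds hxn))
    exact ⟨E, hE, hEc, fun b hb => (hEs hb).2, fun y hy => hWU (hEs hy).1⟩
  choose E hEn hEc hEQ hEU using hE
  choose g hg hg01 hgx hgE using fun n => exists_separating_function (hEn n)
  have hClf : LocallyFinite fun n => (DeltaExt.limit ⁻¹' E n : Set (DeltaExt X)) := hUlf.subset hEU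
  have hsupp : ∀ n, Function.support (fun y : DeltaExt X => 1 - g n y.limit) ⊆
      DeltaExt.limit ⁻¹' E n := by
    intro n y hy
    by_contra hyE
    exact hy (by simp [hgE n _ hyE])
  have hslf := hClf.subset hsupp
  -- A sum of bumps, one at each `x n`, supported inside `L`; thus `G * F` is continuous on all of
  -- `δX`.
  let G : DeltaExt X → ℝ := fun y => ∑ᶠ n, (1 - g n y.limit)
  have hG : Continuous G :=
    continuous_finsum (fun n => continuous_const.sub ((hg n).comp hlim)) hslf
  have hterm : ∀ n (y : DeltaExt X), 0 ≤ 1 - g n y.limit := fun n y => by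
    linarith [(hg01 n y.limit).2]
  have hG0 : ∀ y, 0 ≤ G y := fun y => finsum_nonneg fun n => hterm n y
  have hGx : ∀ n, 1 ≤ G (x n) := by
    intro n
    have h1 := single_le_finsum n (hslf.point_finite (x n)) (fun m => hterm m (x n))
    simpa only [hgx, sub_zero] using h1
  have hGmem : ∀ y, G y ≠ 0 → ∃ n, y.limit ∈ E n := by
    intro y hy
    by_contra! hn
    exact hy (finsum_eq_zero_of_forall_eq_zero fun n => by simp [hgE n _ (hn n)])
  have hh : Continuous fun y => G y * F y := by
    refine continuous_mul_of_continuousOn hG hLo hFL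
      (hClf.isClosed_iUnion fun n => (hEc n).preimage hlim)
      (iUnion_subset fun n y hy => (hEU n hy).1) fun y hy => ?_
    by_contra h
    obtain ⟨n, hn⟩ := hGmem y h
    exact hy (mem_iUnion.2 ⟨n, hn⟩)
  -- Near `u`, `|G * F| ≤ c`, so `G ≥ 1/2` forces `F ≤ 2c`. Since `F > n` on the `n`-th bump, only
  -- bumps with `n < m` can occur there, and their finite union is closed and misses `u`.
  have hQ : ∀ u ∈ hewittRemainder X, u ∉ closure (DeltaExt.limit '' {y | 1 / 2 ≤ G y}) := by
    intro u hu hcl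
    obtain ⟨N, hN, hb⟩ := exists_bounded_near hu ⟨_, hh⟩
    obtain ⟨c, hc⟩ := isBounded_iff_forall_norm_le.1 hb
    obtain ⟨m, hm⟩ := exists_nat_gt (2 * c)
    have hEm : IsClosed (⋃ n ∈ {n | n < m}, E n) :=
      (finite_lt_nat m).isClosed_biUnion fun n _ => hEc n
    have hum : u ∉ ⋃ n ∈ {n | n < m}, E n := by
      simp only [mem_iUnion, not_exists]
      exact fun n _ hun => hEQ n hun (subset_closure hu)
    obtain ⟨_, ⟨hyN, hyE⟩, y, hy, rfl⟩ := mem_closure_iff_nhds.1 hcl _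
      (inter_mem hN (hEm.isOpen_compl.mem_nhds hum))
    have hy : 1 / 2 ≤ G y := hy
    obtain ⟨n, hn⟩ := hGmem y (by linarith)
    have hnF : (n : ℝ) < F y := (hEU n hn).2
    have h1 := (Real.le_norm_self _).trans (hc _ ⟨y, hyN, rfl⟩)
    simp only [ContinuousMap.coe_mk] at h1
    have hn0 : (0 : ℝ) ≤ n := n.cast_nonneg
    have h2 : (n : ℝ) < m := by nlinarith
    exact hyE (mem_biUnion (by exact_mod_cast h2 : n ∈ {n | n < m}) hn)
  have hof : IsDenseEmbedding (DeltaExt.of X) := isDenseEmbedding_of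
  obtain ⟨G', hG', hGe⟩ := exists_stoneCech_extension (f := fun a => min (G (DeltaExt.of X a)) 1)
    ((hG.comp hof.isInducing.continuous).min continuous_const)
    (fun a => ⟨le_min (hG0 _) zero_le_one, min_le_right _ _⟩)
  have hGD : (fun y : DeltaExt X => G' y.limit) = fun y => min (G y) 1 :=
    hof.dense.equalizer (hG'.comp hlim) (hG.min continuous_const)
      (funext fun a => by simp [limit_of, hGe])
  -- `G' ≥ 1` at a cluster point `q` of the `x n`, so `hQ` keeps `q` off `cl Q`. Hence `q` comes
  -- from a point of `L`, where continuity of `F` contradicts `F (x n) > n`.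
  obtain ⟨q, hq⟩ := exists_clusterPt_of_compactSpace (map (fun n => (x n).limit) atTop)
  have hGq : 1 ≤ G' q := by
    have hcl := hq.mem_closure_of_mem _ (image_mem_map univ_mem)
    refine closure_minimal ?_ (isClosed_Ici.preimage hG' : IsClosed (G' ⁻¹' Ici 1)) hcl
    rintro _ ⟨n, -, rfl⟩
    have := congrFun hGD (x n)
    simp only [min_eq_right (hGx n)] at this
    exact this.ge
  have hqQ : q ∉ closure (hewittRemainder X) := by
    intro hcl
    have hO : IsOpen (G' ⁻¹' Ioi (1 / 2)) := isOpen_Ioi.preimage hG'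
    obtain ⟨u, hu, huQ⟩ := mem_closure_iff.1 hcl _ hO (by
      simp only [mem_preimage, mem_Ioi]
      linarith)
    refine hQ u huQ (closure_mono (image_mono ?_)
      (hdense.mem_closure_image_of_mem_nhds (hO.mem_nhds hu)))
    intro y hy
    have h1 := congrFun hGD y
    have h2 : 1 / 2 < G' y.limit := hy
    rw [mem_ofPred_eq]
    linarith [min_le_left (G y) 1]
  obtain ⟨y, rfl⟩ := exists_limit_eq hqQ
  have hyL : y ∈ L := by
    rw [hLeq]
    exact hqQ
  have hV : {z | F z < F y + 1} ∈ 𝓝 y :=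
    (hFL.continuousAt (hLo.mem_nhds hyL)).eventually_lt_const (lt_add_one _)
  rw [isEmbedding_limit.isInducing.nhds_eq_comap] at hV
  obtain ⟨W, hW, hWV⟩ := hV
  obtain ⟨m, hm⟩ := exists_nat_gt (F y + 1)
  obtain ⟨_, hz, n, hn, rfl⟩ := clusterPt_iff_nonempty.1 hq hW (image_mem_map (Ici_mem_atTop m))
  have h1 : F (x n) < F y + 1 := hWV hz
  have h2 : (m : ℝ) ≤ n := by exact_mod_cast hn
  linarith [hxF n]

open Classical in
theorem DeltaExt.isPseudocompactSpace_closure : IsPseudocompactSpace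
    (closure (DeltaExt.locallyCompactPoints X)) := by
  intro f
  -- The default value `0` off the closure is harmless: only continuity on the closure is used. The
  -- bound found on `L` then passes to `cl L`.
  have hF := continuousOn_dite (f := fun z => |f z|) f.continuous.abs
  obtain ⟨n, hn⟩ := exists_le_on_locallyCompactPoints hF
  have hcl := closure_minimal (fun z hz => mem_inter (subset_closure hz) (hn z hz))
    (hF.preimage_isClosed_of_isClosed isClosed_closure (isClosed_Iic (a := (n : ℝ))))
  refine isBounded_iff_forall_norm_le.2 ⟨n, ?_⟩
  rintro _ ⟨z, rfl⟩
  have hz : (if h : (z : DeltaExt X) ∈ closure (locallyCompactPoints X) then |f ⟨z, h⟩| else 0) ≤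
    (n : ℝ) := (hcl z.2).2
  simpa using hz

theorem DeltaExt.isNearlyPseudocompactSpace : IsNearlyPseudocompactSpace (DeltaExt X) := by
  refine ⟨closure (locallyCompactPoints X), closure (closure (locallyCompactPoints X))ᶜ, ?_,
    ⟨isRegularClosed_closure isOpen_locallyCompactPoints, rfl, isPseudocompactSpace_closure⟩,
    ⟨isRegularClosed_closure isClosed_closure.isOpen_compl, isAntiLocallyRealcompactSpace⟩,
    interior_inter_closure_compl _⟩
  exact eq_univ_of_forall fun p => (em (p ∈ closure (locallyCompactPoints X))).imp_right
    fun h => subset_closure h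

end NearlyPseudocompact

theorem mainTheorem2 (X : Type u) [TopologicalSpace X] [T35Space X] :
    (∀ (T : Type v) [TopologicalSpace T] [T35Space T] (e : X → T), IsDenseEmbedding e →
      (∀ p : T, p ∉ range e → ∃ H : Set X, IsHard H ∧ p ∈ closure (e '' H)) →
      List.TFAE [H2pcMapsExtend.{u, v, w} e, IsSEmbedded e, DisjointZeroSetClosures e,
        ZeroSetClosuresInter e, PointsAreUniqueLimits e]) ∧
    (T35Space (DeltaExt X) ∧ IsNearlyPseudocompactSpace (DeltaExt X) ∧
      IsDenseEmbedding (DeltaExt.of X) ∧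
      (∀ p : DeltaExt X, p ∉ range (DeltaExt.of X) →
        ∃ H : Set X, IsHard H ∧ p ∈ closure (DeltaExt.of X '' H)) ∧
      H2pcMapsExtend.{u, u, w} (DeltaExt.of X) ∧ IsSEmbedded (DeltaExt.of X) ∧
      DisjointZeroSetClosures (DeltaExt.of X) ∧ ZeroSetClosuresInter (DeltaExt.of X) ∧
      PointsAreUniqueLimits (DeltaExt.of X) ∧
      (∀ U : Set (Set X), IsFixedZUltrafilter U ∨ IsHzUltrafilter U →
        ∃ q : DeltaExt X, ConvergesIn (DeltaExt.of X) U q)) := by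
  refine ⟨fun T _ _ e he hp => tfae_h2pcMapsExtend he.toIsDenseInducing hp, ?_⟩
  have hof : IsDenseEmbedding (DeltaExt.of X) := DeltaExt.isDenseEmbedding_of
  have hp : ∀ p : DeltaExt X, p ∉ range (DeltaExt.of X) →
      ∃ H : Set X, IsHard H ∧ p ∈ closure (DeltaExt.of X '' H) :=
    fun _ => DeltaExt.exists_isHard_mem_closure
  have h3 : DisjointZeroSetClosures (DeltaExt.of X) := DeltaExt.disjointZeroSetClosures_of
  have htfae := tfae_h2pcMapsExtend.{u, u, w} hof.toIsDenseInducing hp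
  exact ⟨inferInstance, DeltaExt.isNearlyPseudocompactSpace, hof, hp, (htfae.out 2 0).1 h3,
    (htfae.out 2 1).1 h3, h3, (htfae.out 2 3).1 h3, (htfae.out 2 4).1 h3,
    fun U hU => ⟨⟨U, hU⟩, DeltaExt.convergesIn_self _⟩⟩
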